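/- Let $X$ be a standard Gaussian random variable with distribution $\gamma=N(0,1)$ on $\mathbb R$. For a random variable $Y$ let $P_Y$ be its distribution, and for a finite signed measure $\mu$ on $\mathbb R$ let $\|\mu\|_{\mathrm{var}}=\sup\sum_i|\mu(A_i)|$, the supremum being over all finite measurable partitions $(A_i)$ of $\mathbb R$. Let $m\ge 1$ be an integer. (i) For every real polynomial $f$ of degree $m$ in one variable there is a constant $C_f>0$ such that $$\|P_{f(X)}-P_{f(X)+u}\|_{\mathrm{var}}\le C_f\,|u|^{1/m}\qquad\text{for all } u\in\mathbb R .$$ (ii) For non-constant real polynomials $f,g$ of degree at most $m$ in one variable put $\Delta(f,g)=\|P_{f(X)}-P_{g(X)}\|_{\mathrm{var}}$, $\delta(f,g)=\max_{0\le k\le m}|a_k-b_k|$, where $f(x)=\sum_{k=0}^m a_kx^{m-k}$ and $g(x)=\sum_{k=0}^m b_kx^{m-k}$, and $\|\nabla f\|_\star=\big(\mathbb E|f'(X)|^2\big)^{1/2}$. Then $$\Delta(f,g)\le C\,\delta(f,g)^{1/(m+1)},$$ where the constant $C>0$ depends only on $m$, $\|\nabla f\|_\star$ and $\|\nabla g\|_\star$.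 -/

import Mathlib

open MeasureTheory ProbabilityTheory Polynomial

namespace ImageTV

noncomputable section

/-- The standard Gaussian distribution on the real line, i.e. the law of `X`. -/
abbrev stdGauss : Measure ℝ := gaussianReal 0 1

/-- The total variation norm `‖μ - ν‖_var` of the difference of two finite measures: the supremum
of `∑ i, |μ (A i) - ν (A i)|` over finite measurable partitions of the space (so that it is at
most `2` for probability measures). -/
def tvDist {S : Type*} [MeasurableSpace S] (μ ν : Measure S) [IsFiniteMeasure μ]
    [IsFiniteMeasure ν] : ℝ :=
  (VectorMeasure.variation (μ.toSignedMeasure - ν.toSignedMeasure)).real Set.univ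

/-- The variation in `tvDist` agrees with the one from the Jordan decomposition;
in particular it is finite. -/
theorem tvDist_eq_totalVariation {S : Type*} [MeasurableSpace S] (μ ν : Measure S)
    [IsFiniteMeasure μ] [IsFiniteMeasure ν] :
    tvDist μ ν = ((μ.toSignedMeasure - ν.toSignedMeasure).totalVariation).real Set.univ := by
  rw [tvDist, SignedMeasure.totalVariation_eq_variation]

theorem variation_ne_top {S : Type*} [MeasurableSpace S] (μ ν : Measure S)
    [IsFiniteMeasure μ] [IsFiniteMeasure ν] :
    VectorMeasure.variation (μ.toSignedMeasure - ν.toSignedMeasure) Set.univ ≠ ⊤ := by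
  rw [← SignedMeasure.totalVariation_eq_variation]
  exact measure_ne_top _ _

/-- `‖P_{f(X)} - P_{g(X)}‖_var` for a random variable `X` with distribution `Q`: the law of `f(X)`
is the image of `Q` under `f`. -/
def imageDist (Q : Measure ℝ) [IsFiniteMeasure Q] (f g : ℝ → ℝ) : ℝ :=
  tvDist (Q.map f) (Q.map g)

/-- The condition `‖P_{f(X)} - P_{f(X)+u}‖_var ≤ C |u| ^ α` for all real `u`, where `X` has
distribution `Q`. -/
def ShiftCondition (Q : Measure ℝ) [IsFiniteMeasure Q] (f : ℝ → ℝ) (α C : ℝ) : Prop :=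
  ∀ u : ℝ, imageDist Q f (fun x => f x + u) ≤ C * |u| ^ α

/-- `‖∇f‖_⋆ = (E |f'(X)|²)^{1/2}` for a polynomial in one standard Gaussian variable
(in dimension one the only unit directions are `±1`). -/
def gradNorm (f : ℝ[X]) : ℝ :=
  Real.sqrt (∫ x, (f.derivative.eval x) ^ 2 ∂stdGauss)

/-- The maximal difference of the coefficients of `x ^ k`, `0 ≤ k ≤ m`, of two polynomials. -/
def coeffDist (m : ℕ) (f g : ℝ[X]) : ℝ :=
  (Finset.range (m + 1)).sup' Finset.nonempty_range_add_one (fun k => |f.coeff k - g.coeff k|)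

end

end ImageTV

namespace ImageTV

/-! ### Duality for the total variation distance -/

/-! By duality it suffices to test against continuous `φ` with `|φ| ≤ 1`. Both parts rest on one
estimate, `exists_abs_integral_comp_le`: if `ψ = Φ'`, `|Φ| ≤ b` and `|ψ| ≤ 2`, then `E ψ(f(X)) = O(b
^ (1/m))`, with a constant depending only on `m` and `gradNorm f`.

For its proof let `p = f'`, of degree at most `n = m - 1`, and split `1 = p²/(p² + τ²) + τ²/(p² +
τ²)`. In the first term `ψ(f) p` is the derivative of `Φ(f)`; Gaussian integration by parts against
`k = p/(p² + τ²)` gives `O(b/τ)`, because `|k| ≤ 1/τ` and the roots of `p - iτ` bound the `L¹` norm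
of `k'` by `nπ/τ`. The second term is a smoothed small-ball probability for `p`, of order `τ ^
(1/n)`, by factoring `p` over `ℂ`. Taking `τ = b ^ (n/m)` makes both `b ^ (1/m)`; for `n = 0` no
splitting is needed.

For (i), `ψ = φ - φ(· + u)` has a primitive bounded by `|u|`. For (ii), replace `φ` by its moving
average `χ` over length `ε`: `φ - χ` has a primitive bounded by `ε`, while `χ` is `2/ε`-Lipschitz
and `E|f - g| = O(δ)`. The total `ε ^ (1/m) + δ/ε` is balanced by `ε = δ ^ (m/(m+1))`. -/

theorem exists_measurableSet_tvDist_eq {S : Type*} [MeasurableSpace S] (μ ν : Measure S)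
    [IsFiniteMeasure μ] [IsFiniteMeasure ν] :
    ∃ A : Set S, MeasurableSet A ∧
      tvDist μ ν = (μ.real A - ν.real A) - (μ.real Aᶜ - ν.real Aᶜ) := by
  obtain ⟨A, hA, hpos, hneg, h1, h2⟩ :=
    (μ.toSignedMeasure - ν.toSignedMeasure).toJordanDecomposition_spec
  refine ⟨A, hA, ?_⟩
  rw [tvDist_eq_totalVariation, SignedMeasure.totalVariation, measureReal_add_apply, h1, h2,
    SignedMeasure.toMeasureOfZeroLE_real_apply _ _ _ MeasurableSet.univ,
    SignedMeasure.toMeasureOfLEZero_real_apply _ _ _ MeasurableSet.univ, Set.inter_univ,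
    Set.inter_univ, Measure.toSignedMeasure_sub_apply hA,
    Measure.toSignedMeasure_sub_apply hA.compl]
  ring

theorem tvDist_self {S : Type*} [MeasurableSpace S] (μ : Measure S) [IsFiniteMeasure μ] :
    tvDist μ μ = 0 := by
  obtain ⟨A, -, h⟩ := exists_measurableSet_tvDist_eq μ μ
  rw [h]; ring

/-- The total variation distance is controlled by continuous test functions with values
in `[-1, 1]`. -/
theorem tvDist_le_of_forall_continuous (μ ν : Measure ℝ) [IsFiniteMeasure μ] [IsFiniteMeasure ν]
    {B : ℝ} (h : ∀ φ : ℝ → ℝ, Continuous φ → (∀ x, |φ x| ≤ 1) →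
      |∫ x, φ x ∂μ - ∫ x, φ x ∂ν| ≤ B) : tvDist μ ν ≤ B := by
  obtain ⟨A, hA, hd⟩ := exists_measurableSet_tvDist_eq μ ν
  set s : ℝ → ℝ := fun x => A.indicator 1 x - Aᶜ.indicator 1 x with hs
  have hi (ρ : Measure ℝ) [IsFiniteMeasure ρ] (D : Set ℝ) (hD : MeasurableSet D) :
      Integrable (D.indicator (1 : ℝ → ℝ)) ρ := (integrable_const (1 : ℝ)).indicator hD
  have hsi (ρ : Measure ℝ) [IsFiniteMeasure ρ] : Integrable s ρ :=
    (hi ρ A hA).sub (hi ρ Aᶜ hA.compl)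
  have hsv (ρ : Measure ℝ) [IsFiniteMeasure ρ] : ∫ x, s x ∂ρ = ρ.real A - ρ.real Aᶜ := by
    rw [hs, integral_sub (hi ρ A hA) (hi ρ Aᶜ hA.compl), integral_indicator_one hA,
      integral_indicator_one hA.compl]
  have hs1 (x : ℝ) : |s x| ≤ 1 := by
    by_cases hx : x ∈ A <;> simp [hs, hx]
  refine le_of_forall_pos_le_add fun ε hε => ?_
  -- Approximating in `L¹(μ + ν)` serves both measures with a single function. Clamping it to `[-1,
  -- 1]` cannot increase the error, since the clamp is 1-Lipschitz and fixes `s`.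
  obtain ⟨g, hg, -⟩ := (hsi (μ + ν)).exists_boundedContinuous_integral_sub_le hε
  set φ : ℝ → ℝ := fun x => max (-1) (min 1 (g x)) with hφ
  have hφc : Continuous φ := by fun_prop
  have hφ1 (x : ℝ) : |φ x| ≤ 1 := by
    rw [abs_le]; exact ⟨le_max_left _ _, max_le (by norm_num) (min_le_left _ _)⟩
  have hφi (ρ : Measure ℝ) [IsFiniteMeasure ρ] : Integrable φ ρ :=
    Integrable.of_bound hφc.aestronglyMeasurable 1 (Filter.Eventually.of_forall hφ1)
  have hcl (x : ℝ) : |s x - φ x| ≤ |s x - g x| := by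
    have h1 : s x = max (-1) (min 1 (s x)) := by
      rw [min_eq_right (abs_le.1 (hs1 x)).2, max_eq_right (abs_le.1 (hs1 x)).1]
    have h2 : |s x - φ x| = |max (-1) (min 1 (s x)) - max (-1) (min 1 (g x))| := by rw [← h1]
    refine h2.trans_le <| (abs_max_sub_max_le_max (-1) (min 1 (s x)) (-1) (min 1 (g x))).trans
      (max_le (by simp) ?_)
    exact (abs_min_sub_min_le_max 1 (s x) 1 (g x)).trans (max_le (by simp) le_rfl)
  have hsum : ∫ x, |s x - φ x| ∂(μ + ν) ≤ ε :=
    (integral_mono ((hsi _).sub (hφi _)).abs ((hsi _).sub (g.integrable _)).abs hcl).trans hg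
  rw [integral_add_measure (f := fun x => |s x - φ x|) ((hsi _).sub (hφi _)).abs
    ((hsi _).sub (hφi _)).abs] at hsum
  have hb (ρ : Measure ℝ) [IsFiniteMeasure ρ] :
      |∫ x, s x ∂ρ - ∫ x, φ x ∂ρ| ≤ ∫ x, |s x - φ x| ∂ρ := by
    rw [← integral_sub (hsi _) (hφi _)]
    exact abs_integral_le_integral_abs
  have h1 := abs_le.1 (hb μ)
  have h2 := abs_le.1 (hb ν)
  have h3 := abs_le.1 (h φ hφc hφ1)
  rw [hsv] at h1 h2
  rw [hd]
  linarith [h1.1, h1.2, h2.1, h2.2, h3.1, h3.2]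

/-! ### Cauchy kernels -/

theorem integral_multiset_sum_le {S α : Type*} [MeasurableSpace S] {μ : Measure S}
    {g : α → S → ℝ} {c : ℝ} (hg : ∀ a, Integrable (g a) μ) (hc : ∀ a, ∫ x, g a x ∂μ ≤ c)
    (Z : Multiset α) : Integrable (fun x => (Z.map fun a => g a x).sum) μ ∧
      ∫ x, (Z.map fun a => g a x).sum ∂μ ≤ Z.card * c := by
  induction Z using Multiset.induction_on with
  | empty => simp
  | cons a Z ih =>
    simp only [Multiset.map_cons, Multiset.sum_cons, Multiset.card_cons]
    refine ⟨(hg a).add ih.1, ?_⟩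
    rw [integral_add (hg a) ih.1]
    push_cast
    linarith [hc a, ih.2]

theorem integrable_cauchyKernel (a b : ℝ) :
    Integrable (fun x : ℝ => |b| / ((x - a) ^ 2 + b ^ 2)) := by
  rcases eq_or_ne b 0 with rfl | hb
  · simp
  have h := ((integrable_inv_one_add_sq.comp_div hb).comp_sub_right a).const_mul (|b| / b ^ 2)
  refine h.congr (Filter.Eventually.of_forall fun x => ?_)
  have : (x - a) ^ 2 + b ^ 2 ≠ 0 := by positivity
  have : 1 + ((x - a) / b) ^ 2 ≠ 0 := by positivity
  simp only
  field_simp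
  ring

theorem integral_cauchyKernel_le (a b : ℝ) :
    ∫ x : ℝ, |b| / ((x - a) ^ 2 + b ^ 2) ≤ Real.pi := by
  rcases eq_or_ne b 0 with rfl | hb
  · simpa using Real.pi_pos.le
  have h : ∫ x : ℝ, |b| / ((x - a) ^ 2 + b ^ 2) =
      ∫ x : ℝ, (|b| / b ^ 2) * (1 + ((x - a) / b) ^ 2)⁻¹ := by
    refine integral_congr_ae (Filter.Eventually.of_forall fun x => ?_)
    have : (x - a) ^ 2 + b ^ 2 ≠ 0 := by positivity
    have : 1 + ((x - a) / b) ^ 2 ≠ 0 := by positivity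
    simp only
    field_simp
    ring
  rw [h, integral_const_mul, integral_sub_right_eq_self (fun x : ℝ => (1 + (x / b) ^ 2)⁻¹) a,
    Measure.integral_comp_div (fun x : ℝ => (1 + x ^ 2)⁻¹) b, integral_univ_inv_one_add_sq,
    smul_eq_mul, ← mul_assoc, div_mul_eq_mul_div, abs_mul_abs_self, ← sq, div_self (by positivity),
    one_mul]

/-! ### The variation of `arctan (p / τ)` for a polynomial `p` -/

/-- A polynomial `p` of degree at most `n` satisfies `τ |p'| / (p ^ 2 + τ ^ 2) ≤ H` where the
integral of `H` is at most `n π`. -/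
theorem exists_integrable_bound_derivative_div (p : ℝ[X]) {n : ℕ} (hn : p.natDegree ≤ n) {τ : ℝ}
    (hτ : 0 < τ) : ∃ H : ℝ → ℝ, Integrable H ∧ ∫ x, H x ≤ n * Real.pi ∧
      ∀ x, τ * |p.derivative.eval x| / (p.eval x ^ 2 + τ ^ 2) ≤ H x := by
  -- On the real line `τ p'/(p² + τ²)` is the imaginary part of `q'/q` for `q = p - iτ`, which has
  -- no real zero. Expanding `q'/q` over the roots of `q` gives at most `n` Cauchy kernels, each of
  -- integral at most `π`.
  set q : ℂ[X] := p.map Complex.ofRealHom - C (τ * Complex.I) with hq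
  have hev (x : ℝ) : q.eval (x : ℂ) = ((p.eval x : ℝ) : ℂ) - τ * Complex.I := by
    have : (p.map Complex.ofRealHom).eval (x : ℂ) = ((p.eval x : ℝ) : ℂ) := by
      simpa using (eval_map_apply Complex.ofRealHom (p := p) x)
    simp [hq, this]
  have hdev (x : ℝ) : q.derivative.eval (x : ℂ) = ((p.derivative.eval x : ℝ) : ℂ) := by
    have : (p.derivative.map Complex.ofRealHom).eval (x : ℂ) = ((p.derivative.eval x : ℝ) : ℂ) := by
      simpa using (eval_map_apply Complex.ofRealHom (p := p.derivative) x)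
    simp [hq, derivative_map, this]
  have hne (x : ℝ) : q.eval (x : ℂ) ≠ 0 := by
    intro h0
    have := congrArg Complex.im ((hev x).symm.trans h0)
    simp at this
    exact hτ.ne' this
  have hcard : (q.roots.card : ℝ) ≤ n := by
    have h1 := q.card_roots'
    have h2 : q.natDegree ≤ n := by
      refine (natDegree_sub_C (p := p.map Complex.ofRealHom) (a := τ * Complex.I)).le.trans ?_
      exact natDegree_map_le.trans hn
    exact_mod_cast h1.trans h2
  set κ : ℂ → ℝ → ℝ := fun z x => |z.im| / ((x - z.re) ^ 2 + z.im ^ 2) with hκ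
  have hsum := integral_multiset_sum_le (fun z => integrable_cauchyKernel z.re z.im)
    (fun z => integral_cauchyKernel_le z.re z.im) q.roots
  refine ⟨fun x => (q.roots.map fun z => κ z x).sum, ?_, ?_, fun x => ?_⟩
  · exact hsum.1
  · exact hsum.2.trans (mul_le_mul_of_nonneg_right hcard Real.pi_pos.le)
  · have hlog := (IsAlgClosed.splits q).eval_derivative_div_eval_of_ne_zero (hne x)
    have him : τ * |p.derivative.eval x| / (p.eval x ^ 2 + τ ^ 2) =
        |(q.derivative.eval (x : ℂ) / q.eval (x : ℂ)).im| := by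
      have h0 : p.eval x * p.eval x + τ * τ = p.eval x ^ 2 + τ ^ 2 := by ring
      rw [hev, hdev, Complex.div_im]
      simp [Complex.normSq_apply, h0]
      rw [abs_div, abs_neg, abs_mul, abs_of_pos hτ,
        abs_of_pos (by positivity : 0 < p.eval x ^ 2 + τ ^ 2),
        mul_comm]
    rw [him, hlog]
    induction q.roots using Multiset.induction_on with
    | empty => simp
    | cons z Z ih =>
      simp only [Multiset.map_cons, Multiset.sum_cons, Complex.add_im]
      refine (abs_add_le _ _).trans (add_le_add (le_of_eq ?_) ih)
      rw [Complex.div_im]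
      simp [Complex.normSq_apply, hκ, abs_div]
      rw [abs_of_nonneg (add_nonneg (mul_self_nonneg (x - z.re)) (mul_self_nonneg z.im))]
      ring_nf

/-! ### The Gaussian density and Gaussian moments -/

theorem integral_stdGauss (g : ℝ → ℝ) :
    ∫ x, g x ∂stdGauss = ∫ x, gaussianPDFReal 0 1 x * g x := by
  rw [stdGauss, integral_gaussianReal_eq_integral_smul one_ne_zero]
  rfl

theorem gaussianPDFReal_zero_one (x : ℝ) :
    gaussianPDFReal 0 1 x = (Real.sqrt (2 * Real.pi))⁻¹ * Real.exp (-x ^ 2 / 2) := by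
  simp [gaussianPDFReal_def]

theorem inv_sqrt_two_pi_le_one : (Real.sqrt (2 * Real.pi))⁻¹ ≤ 1 := by
  refine inv_le_one_of_one_le₀ ?_
  rw [Real.one_le_sqrt]
  linarith [Real.pi_gt_three]

theorem gaussianPDFReal_le_one (x : ℝ) : gaussianPDFReal 0 1 x ≤ 1 := by
  rw [gaussianPDFReal_zero_one]
  refine mul_le_one₀ inv_sqrt_two_pi_le_one (Real.exp_pos _).le (Real.exp_le_one_iff.2 ?_)
  nlinarith [sq_nonneg x]

theorem one_add_abs_sq_mul_gaussianPDFReal_le (x : ℝ) :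
    (1 + |x|) ^ 2 * gaussianPDFReal 0 1 x ≤ 4 := by
  rw [gaussianPDFReal_zero_one]
  have h1 : (1 + |x|) ^ 2 ≤ 4 * Real.exp (x ^ 2 / 2) := by
    nlinarith [Real.add_one_le_exp (x ^ 2 / 2), sq_nonneg (1 - |x|), sq_abs x]
  have h2 : Real.exp (x ^ 2 / 2) * Real.exp (-x ^ 2 / 2) = 1 := by
    rw [← Real.exp_add]; simp [neg_div]
  calc (1 + |x|) ^ 2 * ((Real.sqrt (2 * Real.pi))⁻¹ * Real.exp (-x ^ 2 / 2))
      ≤ (4 * Real.exp (x ^ 2 / 2)) * (1 * Real.exp (-x ^ 2 / 2)) := by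
        gcongr
        exact inv_sqrt_two_pi_le_one
    _ = 4 := by rw [one_mul, mul_assoc, h2, mul_one]

theorem integrable_one_add_abs_pow (k : ℕ) :
    Integrable (fun x : ℝ => (1 + |x|) ^ k) stdGauss := by
  have h : MemLp (fun x : ℝ => 1 + |x|) k stdGauss :=
    (memLp_const (1 : ℝ)).add (memLp_id_gaussianReal' (k : ENNReal) (by simp)).abs
  refine h.integrable_norm_pow'.congr (Filter.Eventually.of_forall fun x => ?_)
  simp only [Real.norm_eq_abs]
  rw [abs_of_nonneg (by positivity)]

theorem one_le_integral_one_add_abs_pow (k : ℕ) : 1 ≤ ∫ x, (1 + |x|) ^ k ∂stdGauss := by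
  have h := integral_mono (integrable_const (1 : ℝ)) (integrable_one_add_abs_pow k)
    (fun x => one_le_pow₀ (by linarith [abs_nonneg x]))
  simpa using h

theorem abs_eval_le {p : ℝ[X]} {n : ℕ} (hn : p.natDegree ≤ n) {c : ℝ}
    (hc : ∀ k ≤ n, |p.coeff k| ≤ c) (x : ℝ) : |p.eval x| ≤ (n + 1) * c * (1 + |x|) ^ n := by
  rw [eval_eq_sum_range' (Nat.lt_succ_of_le hn)]
  refine (Finset.abs_sum_le_sum_abs _ _).trans ?_
  have : ∀ k ∈ Finset.range (n + 1), |p.coeff k * x ^ k| ≤ c * (1 + |x|) ^ n := by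
    intro k hk
    have hk' : k ≤ n := Nat.lt_succ_iff.1 (Finset.mem_range.1 hk)
    rw [abs_mul, abs_pow]
    refine mul_le_mul (hc k hk') ?_ (by positivity) ((abs_nonneg _).trans (hc k hk'))
    calc |x| ^ k ≤ (1 + |x|) ^ k := by gcongr; linarith
      _ ≤ (1 + |x|) ^ n := pow_le_pow_right₀ (by linarith [abs_nonneg x]) hk'
  refine (Finset.sum_le_sum this).trans (le_of_eq ?_)
  simp; ring

theorem integrable_eval (p : ℝ[X]) : Integrable (fun x => p.eval x) stdGauss := by
  refine ((integrable_one_add_abs_pow p.natDegree).const_mul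
    ((p.natDegree + 1) * ∑ k ∈ Finset.range (p.natDegree + 1), |p.coeff k|)).mono'
    p.continuous.aestronglyMeasurable (Filter.Eventually.of_forall fun x => ?_)
  refine abs_eval_le le_rfl (fun k hk => ?_) x
  exact Finset.single_le_sum (f := fun k => |p.coeff k|) (fun _ _ => abs_nonneg _)
    (Finset.mem_range.2 (Nat.lt_succ_of_le hk))

theorem integrable_eval_sq (p : ℝ[X]) : Integrable (fun x => p.eval x ^ 2) stdGauss := by
  refine (integrable_eval (p ^ 2)).congr (Filter.Eventually.of_forall fun x => ?_)
  simp

theorem integral_eval_sq_pos {p : ℝ[X]} (hp : p ≠ 0) : 0 < ∫ x, p.eval x ^ 2 ∂stdGauss := by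
  rw [integral_pos_iff_support_of_nonneg (fun x => sq_nonneg _) (integrable_eval_sq p)]
  have hsupp : Function.support (fun x => p.eval x ^ 2) = (↑p.roots.toFinset : Set ℝ)ᶜ := by
    ext x; simp [hp]
  have : NullSingletonClass stdGauss := nullSingletonClass_gaussianReal one_ne_zero
  rw [hsupp, prob_compl_eq_one_sub (Finset.measurableSet _), Finset.measure_zero]
  simp

/-! ### Small values of polynomials -/

theorem one_div_one_add_mul_le {a b : ℝ} (ha : 0 ≤ a) (hb : 0 ≤ b) :
    1 / (1 + a * b) ≤ 1 / (1 + a) + 1 / (1 + b) := by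
  rw [div_add_div _ _ (by positivity) (by positivity), div_le_div_iff₀ (by positivity)
    (by positivity)]
  nlinarith [mul_nonneg ha hb, mul_nonneg (mul_nonneg ha hb) (add_nonneg ha hb)]

/-- A smooth union bound: a product can be small only if some factor is. The empty product must be
excluded, as it would give `1/2 ≤ 0`. -/
theorem one_div_one_add_prod_le {α : Type*} (y : α → ℝ) (hy : ∀ a, 0 ≤ y a) (Z : Multiset α)
    (hZ : Z ≠ 0) : 1 / (1 + (Z.map y).prod) ≤ (Z.map fun a => 1 / (1 + y a)).sum := by
  induction Z using Multiset.induction_on with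
  | empty => exact absurd rfl hZ
  | cons a Z ih =>
    rcases eq_or_ne Z 0 with rfl | h
    · simp
    · simp only [Multiset.map_cons, Multiset.prod_cons, Multiset.sum_cons]
      refine (one_div_one_add_mul_le (hy a) (Multiset.prod_nonneg ?_)).trans
        (add_le_add le_rfl (ih h))
      simp only [Multiset.mem_map]
      rintro _ ⟨b, -, rfl⟩
      exact hy b

theorem continuous_one_div_one_add_sq (z : ℂ) (c : ℝ) :
    Continuous fun x : ℝ => 1 / (1 + (‖(x : ℂ) - z‖ / c) ^ 2) := by
  refine continuous_const.div (by fun_prop) fun x => ?_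
  positivity

theorem integrable_one_div_one_add_sq (z : ℂ) (c : ℝ) :
    Integrable (fun x : ℝ => 1 / (1 + (‖(x : ℂ) - z‖ / c) ^ 2)) stdGauss := by
  refine Integrable.of_bound (continuous_one_div_one_add_sq z c).aestronglyMeasurable 1
    (Filter.Eventually.of_forall fun x => ?_)
  rw [Real.norm_eq_abs, abs_of_nonneg (by positivity)]
  exact div_le_one_of_le₀ (by nlinarith [sq_nonneg (‖(x : ℂ) - z‖ / c)]) (by positivity)

/-- The scale `max 1 ‖z‖` makes the bound uniform in the root. Since `max 1 ‖z‖ ≤ (1 + |x|) + ‖x -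
z‖`, the integrand is at most `2η²` plus a Cauchy kernel weighted by `(1 + |x|)²`, and the Gaussian
density absorbs that weight. -/
theorem integral_one_div_one_add_sq_le (z : ℂ) {η : ℝ} (hη : 0 < η) (hη1 : η ≤ 1) :
    ∫ x : ℝ, 1 / (1 + (‖(x : ℂ) - z‖ / (max 1 ‖z‖ * η)) ^ 2) ∂stdGauss
      ≤ (2 + 8 * Real.pi) * η := by
  set M := max 1 ‖z‖ with hM
  have hM1 : 1 ≤ M := le_max_left _ _
  set b : ℝ := Real.sqrt 2 * η with hb
  have hb2 : b ^ 2 = 2 * η ^ 2 := by rw [hb, mul_pow, Real.sq_sqrt (by norm_num)]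
  have hb0 : 0 < b := by positivity
  have hbη : b ≤ 2 * η := by
    rw [hb]
    gcongr
    rw [Real.sqrt_le_left (by norm_num)]; norm_num
  have hpt (x : ℝ) : gaussianPDFReal 0 1 x * (1 / (1 + (‖(x : ℂ) - z‖ / (M * η)) ^ 2)) ≤
      gaussianPDFReal 0 1 x * (2 * η ^ 2) + 4 * b * (|b| / ((x - z.re) ^ 2 + b ^ 2)) := by
    set D := ‖(x : ℂ) - z‖ with hD
    have hD0 : 0 ≤ D := norm_nonneg _
    have hDre : (x - z.re) ^ 2 ≤ D ^ 2 := by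
      have := Complex.abs_re_le_norm ((x : ℂ) - z)
      simp only [Complex.sub_re, Complex.ofReal_re] at this
      rw [← sq_abs (x - z.re)]
      gcongr
    have hMle : M ≤ (1 + |x|) + D := by
      refine max_le (by linarith [abs_nonneg x]) ?_
      have h1 := norm_sub_le (x : ℂ) ((x : ℂ) - z)
      simp only [sub_sub_cancel, Complex.norm_real, Real.norm_eq_abs] at h1
      linarith
    set L := (1 + |x|) ^ 2 with hL
    have hL1 : 1 ≤ L := one_le_pow₀ (by linarith [abs_nonneg x])
    have hM2 : M ^ 2 ≤ 2 * L + 2 * D ^ 2 := by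
      have := pow_le_pow_left₀ (by linarith) hMle 2
      nlinarith [sq_nonneg ((1 + |x|) - D)]
    have hkey : 1 / (1 + (D / (M * η)) ^ 2) ≤
        2 * η ^ 2 + L * (b ^ 2 / ((x - z.re) ^ 2 + b ^ 2)) := by
      have hMη : 0 < (M * η) ^ 2 := by positivity
      have e1 : 1 / (1 + (D / (M * η)) ^ 2) = (M * η) ^ 2 / ((M * η) ^ 2 + D ^ 2) := by
        rw [div_pow]; field_simp
      have hbL : 0 < b ^ 2 * L := by positivity
      have e2 : (M * η) ^ 2 ≤ b ^ 2 * L + 2 * η ^ 2 * D ^ 2 := by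
        rw [hb2, mul_pow]; nlinarith [sq_nonneg η]
      -- Monotonicity of `t ↦ t/(t + D²)`, applied to `e2`.
      have e3 : (M * η) ^ 2 / ((M * η) ^ 2 + D ^ 2) ≤
          (b ^ 2 * L + 2 * η ^ 2 * D ^ 2) / (b ^ 2 * L + 2 * η ^ 2 * D ^ 2 + D ^ 2) := by
        rw [div_le_div_iff₀ (by positivity) (by positivity)]
        nlinarith [mul_le_mul_of_nonneg_right e2 (sq_nonneg D)]
      have e4 : b ^ 2 * L / (b ^ 2 * L + 2 * η ^ 2 * D ^ 2 + D ^ 2) ≤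
          L * (b ^ 2 / ((x - z.re) ^ 2 + b ^ 2)) := by
        rw [← mul_div_assoc, mul_comm L]
        refine div_le_div_of_nonneg_left hbL.le (by positivity) ?_
        nlinarith [mul_nonneg (sq_nonneg η) (sq_nonneg D), sq_nonneg b]
      have e5 : 2 * η ^ 2 * D ^ 2 / (b ^ 2 * L + 2 * η ^ 2 * D ^ 2 + D ^ 2) ≤ 2 * η ^ 2 := by
        rw [div_le_iff₀ (by positivity)]
        nlinarith [mul_nonneg (sq_nonneg η) (by positivity : 0 ≤ b ^ 2 * L + 2 * η ^ 2 * D ^ 2)]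
      rw [e1]
      refine e3.trans ?_
      rw [add_div]
      linarith
    have hw := one_add_abs_sq_mul_gaussianPDFReal_le x
    have hw0 := gaussianPDFReal_nonneg 0 1 x
    calc gaussianPDFReal 0 1 x * (1 / (1 + (D / (M * η)) ^ 2))
        ≤ gaussianPDFReal 0 1 x * (2 * η ^ 2 + L * (b ^ 2 / ((x - z.re) ^ 2 + b ^ 2))) := by gcongr
      _ = gaussianPDFReal 0 1 x * (2 * η ^ 2) +
          (L * gaussianPDFReal 0 1 x) * (b ^ 2 / ((x - z.re) ^ 2 + b ^ 2)) := by ring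
      _ ≤ gaussianPDFReal 0 1 x * (2 * η ^ 2) + 4 * (b ^ 2 / ((x - z.re) ^ 2 + b ^ 2)) := by
          gcongr
      _ = _ := by rw [abs_of_pos hb0]; ring
  have hi1 : Integrable (fun x => gaussianPDFReal 0 1 x * (2 * η ^ 2)) :=
    (integrable_gaussianPDFReal 0 1).mul_const _
  have hi2 := (integrable_cauchyKernel z.re b).const_mul (4 * b)
  rw [integral_stdGauss]
  have hmono : ∫ x, gaussianPDFReal 0 1 x * (1 / (1 + (‖(x : ℂ) - z‖ / (M * η)) ^ 2)) ≤
      ∫ x, gaussianPDFReal 0 1 x * (2 * η ^ 2) + 4 * b * (|b| / ((x - z.re) ^ 2 + b ^ 2)) := by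
    refine integral_mono_of_nonneg (Filter.Eventually.of_forall fun x => ?_) (hi1.add hi2)
      (Filter.Eventually.of_forall hpt)
    exact mul_nonneg (gaussianPDFReal_nonneg 0 1 x) (by positivity)
  refine hmono.trans ?_
  rw [integral_add hi1 hi2, integral_mul_const, integral_const_mul,
    integral_gaussianPDFReal_eq_one 0 one_ne_zero]
  have h1 := integral_cauchyKernel_le z.re b
  have h2 : 4 * b * ∫ x : ℝ, |b| / ((x - z.re) ^ 2 + b ^ 2) ≤ 4 * (2 * η) * Real.pi := by gcongr
  nlinarith

theorem multiset_prod_const_mul {α : Type*} (c : ℝ) (y : α → ℝ) (Z : Multiset α) :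
    (Z.map fun a => c * y a).prod = c ^ Z.card * (Z.map y).prod := by
  rw [Multiset.prod_map_mul]; simp

/-- A smoothed form of the bound `γ(|p| ≤ τ) ≤ C τ ^ (1 / n)` for polynomials of degree at most `n`
with prescribed `L²` norm. -/
theorem exists_integral_sq_div_le {n : ℕ} (hn : 1 ≤ n) {s : ℝ} (hs : 0 < s) :
    ∃ C : ℝ, 0 < C ∧ ∀ p : ℝ[X], p.natDegree ≤ n → ∫ x, p.eval x ^ 2 ∂stdGauss = s ^ 2 →
      ∀ τ : ℝ, 0 < τ →
        ∫ x, τ ^ 2 / (p.eval x ^ 2 + τ ^ 2) ∂stdGauss ≤ C * τ ^ (1 / (n : ℝ)) := by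
  set K := Real.sqrt (∫ x, (1 + |x|) ^ (2 * n) ∂stdGauss) with hK
  have hK2 : K ^ 2 = ∫ x, (1 + |x|) ^ (2 * n) ∂stdGauss :=
    Real.sq_sqrt (zero_le_one.trans (one_le_integral_one_add_abs_pow _))
  have hK0 : 0 < K := Real.sqrt_pos.2 (zero_lt_one.trans_le (one_le_integral_one_add_abs_pow _))
  have hn' : (1 : ℝ) ≤ n := by exact_mod_cast hn
  have hB : 1 ≤ 2 + 8 * Real.pi := by linarith [Real.pi_pos]
  refine ⟨(n * (2 + 8 * Real.pi)) * (K / s) ^ (1 / (n : ℝ)), by positivity,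
    fun p hp hps τ hτ => ?_⟩
  -- The scale for each normalised linear factor: `η ^ n = Kτ/s` distributes `τ` over at most `n`
  -- roots. If `η ≥ 1` the claim is trivial.
  set η := (K / s * τ) ^ (1 / (n : ℝ)) with hη
  have hη0 : 0 < η := by positivity
  have hηn : η ^ n = K / s * τ := by
    rw [hη, one_div, Real.rpow_inv_natCast_pow (by positivity) (by omega)]
  rw [mul_assoc, ← Real.mul_rpow (by positivity) hτ.le, ← hη]
  have hle1 (x : ℝ) : τ ^ 2 / (p.eval x ^ 2 + τ ^ 2) ≤ 1 :=
    div_le_one_of_le₀ (by nlinarith [sq_nonneg (p.eval x)]) (by positivity)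
  have hcont : Continuous fun x => τ ^ 2 / (p.eval x ^ 2 + τ ^ 2) :=
    continuous_const.div (by fun_prop) fun x => by positivity
  have hint : Integrable (fun x => τ ^ 2 / (p.eval x ^ 2 + τ ^ 2)) stdGauss := by
    refine Integrable.of_bound hcont.aestronglyMeasurable 1 (Filter.Eventually.of_forall fun x => ?_)
    rw [Real.norm_eq_abs, abs_of_nonneg (by positivity)]
    exact hle1 x
  rcases le_or_gt 1 η with h1 | h1
  · have h2 := integral_mono hint (integrable_const (1 : ℝ)) hle1
    simp only [integral_const, probReal_univ, smul_eq_mul, mul_one] at h2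
    refine h2.trans ?_
    have : 1 ≤ n * (2 + 8 * Real.pi) := one_le_mul_of_one_le_of_one_le hn' hB
    exact one_le_mul_of_one_le_of_one_le this h1
  set q : ℂ[X] := p.map Complex.ofRealHom with hq
  set Z := q.roots with hZ
  have hZn : Z.card ≤ n := q.card_roots'.trans (natDegree_map_le.trans hp)
  set l : ℝ := ‖q.leadingCoeff‖ with hl
  set M : ℂ → ℝ := fun z => max 1 ‖z‖ with hM
  have hM1 (z : ℂ) : 1 ≤ M z := le_max_left _ _
  have habs (x : ℝ) : |p.eval x| = l * (Z.map fun z => ‖(x : ℂ) - z‖).prod := by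
    have h2 : q.eval (x : ℂ) = ((p.eval x : ℝ) : ℂ) := by
      simpa using (eval_map_apply Complex.ofRealHom (p := p) x)
    have h3 := (IsAlgClosed.splits q).eval_eq_prod_roots (x : ℂ)
    rw [h2] at h3
    have h4 := congrArg norm h3
    rw [Complex.norm_real, Real.norm_eq_abs, norm_mul] at h4
    rw [h4]
    congr 1
    have := map_multiset_prod (normHom : ℂ →*₀ ℝ) (Z.map fun z => (x : ℂ) - z)
    simpa [Multiset.map_map, Function.comp_def] using this
  have hpM (x : ℝ) : (Z.map fun z => ‖(x : ℂ) - z‖).prod =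
      (Z.map M).prod * (Z.map fun z => ‖(x : ℂ) - z‖ / M z).prod := by
    rw [← Multiset.prod_map_mul]
    congr 1
    refine Multiset.map_congr rfl fun z _ => ?_
    rw [mul_div_cancel₀ _ (by linarith [hM1 z])]
  -- The size of `p` once every factor is normalised. The upper bound `|p| ≤ A (1 + |x|) ^ n` and
  -- the prescribed `L²` norm force `s ≤ A K`, hence `τ ≤ A η ^ n`.
  set A : ℝ := l * (Z.map M).prod with hA
  have hA0 : 0 ≤ A := by
    refine mul_nonneg (norm_nonneg _) (Multiset.prod_nonneg ?_)
    simp only [Multiset.mem_map]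
    rintro _ ⟨z, -, rfl⟩
    linarith [hM1 z]
  have habs' (x : ℝ) : |p.eval x| = A * (Z.map fun z => ‖(x : ℂ) - z‖ / M z).prod := by
    rw [habs, hpM, ← mul_assoc]
  have hq0 (x : ℝ) (z : ℂ) : 0 ≤ ‖(x : ℂ) - z‖ / M z :=
    div_nonneg (norm_nonneg _) (by linarith [hM1 z])
  have hup (x : ℝ) : |p.eval x| ≤ A * (1 + |x|) ^ n := by
    rw [habs']
    refine mul_le_mul_of_nonneg_left ?_ hA0
    have h2 : (Z.map fun z => ‖(x : ℂ) - z‖ / M z).prod ≤ (Z.map fun _ => 1 + |x|).prod := by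
      refine Multiset.prod_map_le_prod_map₀ _ _ (fun z _ => hq0 x z) fun z _ => ?_
      rw [div_le_iff₀ (by linarith [hM1 z])]
      have h3 := norm_sub_le (x : ℂ) z
      rw [Complex.norm_real, Real.norm_eq_abs] at h3
      have h4 : ‖z‖ ≤ M z := le_max_right _ _
      nlinarith [abs_nonneg x, hM1 z]
    refine h2.trans ?_
    simp only [Multiset.map_const', Multiset.prod_replicate]
    exact pow_le_pow_right₀ (by linarith [abs_nonneg x]) hZn
  have hsA : s ≤ A * K := by
    refine le_of_sq_le_sq ?_ (by positivity)
    rw [← hps, mul_pow, hK2, ← integral_const_mul]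
    refine integral_mono (integrable_eval_sq p)
      ((integrable_one_add_abs_pow _).const_mul _) fun x => ?_
    have := pow_le_pow_left₀ (abs_nonneg _) (hup x) 2
    rw [sq_abs, mul_pow, ← pow_mul, mul_comm n 2] at this
    exact this
  have hτA : τ ≤ A * η ^ n := by
    rw [hηn, ← mul_assoc, ← mul_div_assoc]
    exact le_mul_of_one_le_left hτ.le ((one_le_div hs).2 hsA)
  have hlow (x : ℝ) : τ * (Z.map fun z => ‖(x : ℂ) - z‖ / (M z * η)).prod * η ^ Z.card ≤
      |p.eval x| * η ^ n := by
    have h2 : (Z.map fun z => ‖(x : ℂ) - z‖ / M z).prod =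
        η ^ Z.card * (Z.map fun z => ‖(x : ℂ) - z‖ / (M z * η)).prod := by
      rw [← multiset_prod_const_mul]
      congr 1
      refine Multiset.map_congr rfl fun z _ => ?_
      have := hM1 z
      field_simp
    have h3 : 0 ≤ (Z.map fun z => ‖(x : ℂ) - z‖ / M z).prod := by
      refine Multiset.prod_nonneg ?_
      simp only [Multiset.mem_map]
      rintro _ ⟨z, -, rfl⟩
      exact hq0 x z
    calc _ = τ * (Z.map fun z => ‖(x : ℂ) - z‖ / M z).prod := by rw [h2]; ring
      _ ≤ (A * η ^ n) * (Z.map fun z => ‖(x : ℂ) - z‖ / M z).prod := by gcongr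
      _ = _ := by rw [habs']; ring
  -- When there are fewer than `n` roots, a power of `η` is left over; the rootless case uses `j =
  -- 1`, the other `j = 0`.
  have hlow' (x : ℝ) (j : ℕ) (hj : j + Z.card ≤ n) :
      τ * (Z.map fun z => ‖(x : ℂ) - z‖ / (M z * η)).prod ≤ |p.eval x| * η ^ j := by
    refine le_of_mul_le_mul_right ((hlow x).trans ?_) (pow_pos hη0 Z.card)
    rw [mul_assoc, ← pow_add]
    exact mul_le_mul_of_nonneg_left (pow_le_pow_of_le_one hη0.le h1.le hj) (abs_nonneg _)
  rcases eq_or_ne Z 0 with h0 | h0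
  · have hpt (x : ℝ) : τ ^ 2 / (p.eval x ^ 2 + τ ^ 2) ≤ η := by
      have h2 := hlow' x 1 (by simpa [h0] using hn)
      simp only [h0, Multiset.map_zero, Multiset.prod_zero, mul_one, pow_one] at h2
      rw [div_le_iff₀ (by positivity)]
      have h3 := pow_le_pow_left₀ hτ.le h2 2
      rw [mul_pow, sq_abs] at h3
      nlinarith [mul_nonneg hη0.le (sq_nonneg τ),
        mul_nonneg (mul_nonneg (sq_nonneg (p.eval x)) hη0.le) (sub_nonneg.2 h1.le)]
    have h2 := integral_mono hint (integrable_const η) hpt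
    simp only [integral_const, probReal_univ, smul_eq_mul, one_mul] at h2
    refine h2.trans (le_mul_of_one_le_left hη0.le ?_)
    exact one_le_mul_of_one_le_of_one_le hn' hB
  · have hpt (x : ℝ) : τ ^ 2 / (p.eval x ^ 2 + τ ^ 2) ≤
        (Z.map fun z => 1 / (1 + (‖(x : ℂ) - z‖ / (M z * η)) ^ 2)).sum := by
      refine le_trans ?_ (one_div_one_add_prod_le (fun z => (‖(x : ℂ) - z‖ / (M z * η)) ^ 2)
        (fun z => sq_nonneg _) Z h0)
      rw [Multiset.prod_map_pow]
      have h2 := hlow' x 0 (by simpa using hZn)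
      rw [pow_zero, mul_one] at h2
      have h4 : 0 ≤ (Z.map fun z => ‖(x : ℂ) - z‖ / (M z * η)).prod := by
        refine Multiset.prod_nonneg ?_
        simp only [Multiset.mem_map]
        rintro _ ⟨z, -, rfl⟩
        exact div_nonneg (norm_nonneg _) (mul_nonneg (by linarith [hM1 z]) hη0.le)
      have h3 := pow_le_pow_left₀ (mul_nonneg hτ.le h4) h2 2
      rw [mul_pow, sq_abs] at h3
      rw [div_le_div_iff₀ (by positivity) (by positivity)]
      linarith
    have hsum : Integrable (fun x : ℝ => (Z.map fun z =>
          1 / (1 + (‖(x : ℂ) - z‖ / (M z * η)) ^ 2)).sum) stdGauss ∧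
        ∫ x : ℝ, (Z.map fun z => 1 / (1 + (‖(x : ℂ) - z‖ / (M z * η)) ^ 2)).sum ∂stdGauss ≤
          Z.card * ((2 + 8 * Real.pi) * η) :=
      integral_multiset_sum_le (fun z => integrable_one_div_one_add_sq z _)
        (fun z => integral_one_div_one_add_sq_le z hη0 h1.le) Z
    refine (integral_mono hint hsum.1 hpt).trans (hsum.2.trans ?_)
    rw [mul_assoc]
    gcongr

/-! ### Gaussian integration by parts -/

theorem integrable_gaussianPDFReal_mul {g : ℝ → ℝ} (hg : Integrable g stdGauss) :
    Integrable (fun x => gaussianPDFReal 0 1 x * g x) := by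
  rw [stdGauss, gaussianReal_of_var_ne_zero 0 one_ne_zero,
    integrable_withDensity_iff_integrable_smul' (measurable_gaussianPDF 0 1)
      (Filter.Eventually.of_forall fun _ => gaussianPDF_lt_top)] at hg
  refine hg.congr (Filter.Eventually.of_forall fun x => ?_)
  simp [toReal_gaussianPDF]

theorem hasDerivAt_gaussianPDFReal (x : ℝ) :
    HasDerivAt (gaussianPDFReal 0 1) (-x * gaussianPDFReal 0 1 x) x := by
  have h : gaussianPDFReal 0 1 =
      fun x => (Real.sqrt (2 * Real.pi))⁻¹ * Real.exp (-x ^ 2 / 2) :=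
    funext gaussianPDFReal_zero_one
  rw [h]
  refine HasDerivAt.congr_deriv
    ((((hasDerivAt_pow 2 x).neg.div_const 2).exp).const_mul (Real.sqrt (2 * Real.pi))⁻¹) ?_
  simp
  ring

theorem integrable_abs_stdGauss : Integrable (fun x : ℝ => |x|) stdGauss := by
  simpa using (integrable_eval (X : ℝ[X])).abs

/-- The derivative of density times `Φ(f) k` integrates to zero over the line; differentiating the
density produces the term `x k`. -/
theorem integral_comp_mul_deriv_mul {Φ ψ k k' : ℝ → ℝ} {b c κ : ℝ}
    (hΦ : ∀ y, HasDerivAt Φ (ψ y) y) (hψ : Continuous ψ) (hb : ∀ y, |Φ y| ≤ b)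
    (hc : ∀ y, |ψ y| ≤ c) (f : ℝ[X]) (hk : ∀ x, HasDerivAt k (k' x) x) (hκ : ∀ x, |k x| ≤ κ)
    (hk' : Integrable k' stdGauss) :
    ∫ x, ψ (f.eval x) * (f.derivative.eval x * k x) ∂stdGauss =
      ∫ x, Φ (f.eval x) * (x * k x - k' x) ∂stdGauss := by
  have hkc : Continuous k := continuous_iff_continuousAt.2 fun x => (hk x).continuousAt
  have hΦc : Continuous Φ := continuous_iff_continuousAt.2 fun x => (hΦ x).continuousAt
  have i1 : Integrable (fun x => ψ (f.eval x) * (f.derivative.eval x * k x)) stdGauss := by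
    refine Integrable.bdd_mul (c := c) ?_ (by fun_prop) (Filter.Eventually.of_forall fun x => hc _)
    exact (integrable_eval _).mul_bdd (c := κ) (by fun_prop) (Filter.Eventually.of_forall hκ)
  have i2 : Integrable (fun x => Φ (f.eval x) * (x * k x - k' x)) stdGauss := by
    refine Integrable.bdd_mul (c := b) ?_ (by fun_prop) (Filter.Eventually.of_forall fun x => hb _)
    refine Integrable.sub ?_ hk'
    have : Integrable (fun x : ℝ => x) stdGauss := by simpa using integrable_eval (X : ℝ[X])
    exact this.mul_bdd (c := κ) (by fun_prop) (Filter.Eventually.of_forall hκ)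
  have i3 : Integrable (fun x => Φ (f.eval x) * k x) stdGauss := by
    refine Integrable.of_bound (by fun_prop) (b * κ) (Filter.Eventually.of_forall fun x => ?_)
    rw [Real.norm_eq_abs, abs_mul]
    exact mul_le_mul (hb _) (hκ _) (abs_nonneg _) ((abs_nonneg _).trans (hb 0))
  have hd (x : ℝ) : HasDerivAt (fun x => gaussianPDFReal 0 1 x * (Φ (f.eval x) * k x))
      (gaussianPDFReal 0 1 x * (ψ (f.eval x) * (f.derivative.eval x * k x)) -
        gaussianPDFReal 0 1 x * (Φ (f.eval x) * (x * k x - k' x))) x := by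
    refine HasDerivAt.congr_deriv ((hasDerivAt_gaussianPDFReal x).mul
      (((hΦ (f.eval x)).comp x (f.hasDerivAt x)).mul (hk x))) ?_
    simp only [Function.comp]
    ring
  have j1 := integrable_gaussianPDFReal_mul i1
  have j2 := integrable_gaussianPDFReal_mul i2
  have h0 := integral_eq_zero_of_hasDerivAt_of_integrable hd (j1.sub j2)
    (integrable_gaussianPDFReal_mul i3)
  rw [integral_sub j1 j2] at h0
  rw [integral_stdGauss, integral_stdGauss]
  linarith

theorem abs_integral_comp_mul_deriv_mul_le {Φ ψ k k' : ℝ → ℝ} {b c κ : ℝ}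
    (hΦ : ∀ y, HasDerivAt Φ (ψ y) y) (hψ : Continuous ψ) (hb : ∀ y, |Φ y| ≤ b)
    (hc : ∀ y, |ψ y| ≤ c) (f : ℝ[X]) (hk : ∀ x, HasDerivAt k (k' x) x) (hκ : ∀ x, |k x| ≤ κ)
    (hk' : Integrable k' stdGauss) :
    |∫ x, ψ (f.eval x) * (f.derivative.eval x * k x) ∂stdGauss| ≤
      b * (κ * ∫ x, |x| ∂stdGauss + ∫ x, |k' x| ∂stdGauss) := by
  rw [integral_comp_mul_deriv_mul hΦ hψ hb hc f hk hκ hk', ← integral_const_mul, ←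
    integral_add (integrable_abs_stdGauss.const_mul κ) hk'.abs, ← integral_const_mul,
    ← Real.norm_eq_abs]
  refine norm_integral_le_of_norm_le
    (((integrable_abs_stdGauss.const_mul κ).add hk'.abs).const_mul b)
    (Filter.Eventually.of_forall fun x => ?_)
  rw [Real.norm_eq_abs, abs_mul]
  refine mul_le_mul (hb _) ?_ (abs_nonneg _) ((abs_nonneg _).trans (hb 0))
  refine (abs_sub _ _).trans (add_le_add ?_ le_rfl)
  rw [abs_mul, mul_comm]
  exact mul_le_mul_of_nonneg_right (hκ x) (abs_nonneg _)

/-! ### The fractional Hardy–Landau–Littlewood type bound -/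

theorem gradNorm_sq (f : ℝ[X]) :
    gradNorm f ^ 2 = ∫ x, f.derivative.eval x ^ 2 ∂stdGauss :=
  Real.sq_sqrt (integral_nonneg fun _ => sq_nonneg _)

theorem gradNorm_pos {f : ℝ[X]} (hf : 1 ≤ f.natDegree) : 0 < gradNorm f := by
  refine Real.sqrt_pos.2 (integral_eval_sq_pos fun h => ?_)
  have := derivative_eq_zero.1 h
  omega

theorem hasDerivAt_div_sq_add_sq (p : ℝ[X]) {τ : ℝ} (hτ : 0 < τ) (x : ℝ) :
    HasDerivAt (fun x => p.eval x / (p.eval x ^ 2 + τ ^ 2))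
      (p.derivative.eval x * (τ ^ 2 - p.eval x ^ 2) / (p.eval x ^ 2 + τ ^ 2) ^ 2) x := by
  have hne : p.eval x ^ 2 + τ ^ 2 ≠ 0 := by positivity
  refine HasDerivAt.congr_deriv ((p.hasDerivAt x).div
    (((p.hasDerivAt x).pow 2).add_const (τ ^ 2)) hne) ?_
  congr 1
  simp
  ring

theorem abs_div_sq_add_sq_le (y : ℝ) {τ : ℝ} (hτ : 0 < τ) : |y / (y ^ 2 + τ ^ 2)| ≤ 1 / τ := by
  rw [abs_div, abs_of_pos (by positivity : 0 < y ^ 2 + τ ^ 2), div_le_div_iff₀ (by positivity) hτ]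
  nlinarith [sq_nonneg (|y| - τ), sq_abs y, sq_nonneg y, sq_nonneg τ]

/-- The integrand is at most `|p'|/(p² + τ²)` in absolute value, and the density is at most `1`, so
the Lebesgue bound by counting roots applies; the coefficients of `p` do not enter. -/
theorem integral_abs_deriv_div_sq_add_sq_le (p : ℝ[X]) {n : ℕ} (hn : p.natDegree ≤ n) {τ : ℝ}
    (hτ : 0 < τ) :
    Integrable (fun x => p.derivative.eval x * (τ ^ 2 - p.eval x ^ 2) /
      (p.eval x ^ 2 + τ ^ 2) ^ 2) stdGauss ∧
    ∫ x, |p.derivative.eval x * (τ ^ 2 - p.eval x ^ 2) / (p.eval x ^ 2 + τ ^ 2) ^ 2| ∂stdGauss ≤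
      n * Real.pi / τ := by
  obtain ⟨H, hH, hHn, hb⟩ := exists_integrable_bound_derivative_div p hn hτ
  set k' : ℝ → ℝ := fun x => p.derivative.eval x * (τ ^ 2 - p.eval x ^ 2) /
      (p.eval x ^ 2 + τ ^ 2) ^ 2 with hk'
  have hcont : Continuous k' := by
    refine Continuous.div (by fun_prop) (by fun_prop) fun x => ?_
    positivity
  have hle1 (x : ℝ) : |k' x| ≤ |p.derivative.eval x| / (p.eval x ^ 2 + τ ^ 2) := by
    have h1 : |τ ^ 2 - p.eval x ^ 2| ≤ p.eval x ^ 2 + τ ^ 2 := by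
      rw [abs_le]; constructor <;> nlinarith [sq_nonneg τ, sq_nonneg (p.eval x)]
    have h2 : 0 < p.eval x ^ 2 + τ ^ 2 := by positivity
    rw [hk', abs_div, abs_mul, abs_of_pos (by positivity : 0 < (p.eval x ^ 2 + τ ^ 2) ^ 2),
      div_le_div_iff₀ (by positivity) h2]
    nlinarith [mul_le_mul_of_nonneg_left h1 (mul_nonneg (abs_nonneg (p.derivative.eval x)) h2.le)]
  have hle2 (x : ℝ) : |p.derivative.eval x| / (p.eval x ^ 2 + τ ^ 2) ≤ H x / τ := by
    rw [le_div_iff₀ hτ]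
    refine le_trans (le_of_eq ?_) (hb x)
    ring
  have hint : Integrable k' stdGauss := by
    refine ((integrable_eval p.derivative).abs.mul_const (1 / τ ^ 2)).mono'
      hcont.aestronglyMeasurable (Filter.Eventually.of_forall fun x => (hle1 x).trans ?_)
    rw [div_eq_mul_one_div]
    gcongr
    nlinarith [sq_nonneg (p.eval x)]
  refine ⟨hint, ?_⟩
  rw [integral_stdGauss]
  have : ∫ x, gaussianPDFReal 0 1 x * |k' x| ≤ ∫ x, H x / τ := by
    refine integral_mono (integrable_gaussianPDFReal_mul hint.abs) (hH.div_const τ) fun x => ?_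
    exact (mul_le_of_le_one_left (abs_nonneg _) (gaussianPDFReal_le_one x)).trans
      ((hle1 x).trans (hle2 x))
  refine this.trans ?_
  rw [integral_div]
  gcongr

/-- `|E ψ(f(X))| ≤ C ‖Φ‖_∞ ^ (1 / m)` if `ψ = Φ'` and `|ψ| ≤ 2`, where the constant `C` depends
only on `m` and on `‖∇f‖_⋆`. -/
theorem exists_abs_integral_comp_le {m : ℕ} (hm : 1 ≤ m) {s : ℝ} (hs : 0 < s) :
    ∃ C : ℝ, 0 < C ∧ ∀ f : ℝ[X], f.natDegree ≤ m → gradNorm f = s →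
      ∀ (Φ ψ : ℝ → ℝ) (b : ℝ), 0 < b → (∀ y, HasDerivAt Φ (ψ y) y) → Continuous ψ →
        (∀ y, |Φ y| ≤ b) → (∀ y, |ψ y| ≤ 2) →
        |∫ x, ψ (f.eval x) ∂stdGauss| ≤ C * b ^ (1 / (m : ℝ)) := by
  have hE : 0 ≤ ∫ x, |x| ∂stdGauss := integral_nonneg fun x => abs_nonneg x
  set E := ∫ x, |x| ∂stdGauss with hEdef
  obtain ⟨n, rfl⟩ : ∃ n, m = n + 1 := ⟨m - 1, by omega⟩
  have hder (f : ℝ[X]) (hf : f.natDegree ≤ n + 1) : f.derivative.natDegree ≤ n :=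
    (natDegree_derivative_le f).trans (by omega)
  rcases Nat.eq_zero_or_pos n with rfl | hn
  -- Here `f'` is a constant `c` with `|c| = s`, so integration by parts with weight `1/c` suffices.
  -- The `+ 1` only secures positivity, `E` being known merely as nonnegative.
  · refine ⟨(1 / s) * E + 1, by positivity, fun f hf hfs Φ ψ b hb hΦ hψ hΦb hψ2 => ?_⟩
    obtain ⟨c, hc⟩ : ∃ c, f.derivative = C c :=
      ⟨_, eq_C_of_natDegree_le_zero (hder f hf)⟩
    have hcs : |c| = s := by
      have h := gradNorm_sq f
      rw [hfs, hc] at h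
      simp only [eval_C, integral_const, probReal_univ, smul_eq_mul, one_mul] at h
      rw [← abs_of_pos hs]
      exact (sq_eq_sq_iff_abs_eq_abs _ _).1 h.symm
    have hc0 : c ≠ 0 := by
      rintro rfl
      simp at hcs
      exact hs.ne hcs
    have h := abs_integral_comp_mul_deriv_mul_le hΦ hψ hΦb hψ2 f (k := fun _ => 1 / c)
      (k' := fun _ => 0) (κ := 1 / s) (fun x => hasDerivAt_const x _)
      (fun x => by rw [abs_div, abs_one, hcs]) (integrable_zero _ _ _)
    simp only [hc, eval_C, mul_one_div_cancel hc0, mul_one, abs_zero, integral_zero,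
      add_zero] at h
    simp only [zero_add, Nat.cast_one, div_one, Real.rpow_one]
    refine h.trans ?_
    rw [← hEdef]
    linarith
  · obtain ⟨C₀, hC₀, hsub⟩ := exists_integral_sq_div_le hn hs
    refine ⟨E + n * Real.pi + 2 * C₀, by positivity,
      fun f hf hfs Φ ψ b hb hΦ hψ hΦb hψ2 => ?_⟩
    set p := f.derivative with hp
    have hn' : (n : ℝ) ≠ 0 := by positivity
    set r : ℝ := 1 / ((n + 1 : ℕ) : ℝ) with hr
    -- Solves `b/τ = τ ^ (1/n)`, equating the two error terms.
    set τ : ℝ := b ^ (n * r) with hτdef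
    have hτ : 0 < τ := by positivity
    have hbτ : b / τ = b ^ r := by
      rw [hτdef, div_eq_iff (by positivity), ← Real.rpow_add hb]
      have : r + n * r = 1 := by rw [hr]; push_cast; field_simp; ring
      rw [this, Real.rpow_one]
    have hτn : τ ^ (1 / (n : ℝ)) = b ^ r := by
      rw [hτdef, ← Real.rpow_mul hb.le]
      congr 1
      field_simp
    have hdeg := hder f hf
    obtain ⟨hki, hkb⟩ := integral_abs_deriv_div_sq_add_sq_le p hdeg hτ
    have h1 := abs_integral_comp_mul_deriv_mul_le hΦ hψ hΦb hψ2 f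
      (hasDerivAt_div_sq_add_sq p hτ) (fun x => abs_div_sq_add_sq_le (p.eval x) hτ) hki
    have h2 := hsub p hdeg (by rw [← hfs, gradNorm_sq]) τ hτ
    have hqc : Continuous fun x => τ ^ 2 / (p.eval x ^ 2 + τ ^ 2) :=
      continuous_const.div (by fun_prop) fun x => by positivity
    have hq1 (x : ℝ) : τ ^ 2 / (p.eval x ^ 2 + τ ^ 2) ≤ 1 :=
      div_le_one_of_le₀ (by nlinarith [sq_nonneg (p.eval x)]) (by positivity)
    have hq0 (x : ℝ) : 0 ≤ τ ^ 2 / (p.eval x ^ 2 + τ ^ 2) := by positivity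
    have hqi : Integrable (fun x => τ ^ 2 / (p.eval x ^ 2 + τ ^ 2)) stdGauss := by
      refine Integrable.of_bound hqc.aestronglyMeasurable 1
        (Filter.Eventually.of_forall fun x => ?_)
      rw [Real.norm_eq_abs, abs_of_nonneg (hq0 x)]
      exact hq1 x
    have hψi : Integrable (fun x => ψ (f.eval x)) stdGauss :=
      Integrable.of_bound (by fun_prop) 2 (Filter.Eventually.of_forall fun x => hψ2 _)
    have hψqi : Integrable (fun x => ψ (f.eval x) * (τ ^ 2 / (p.eval x ^ 2 + τ ^ 2))) stdGauss :=
      hqi.bdd_mul (c := 2) (by fun_prop) (Filter.Eventually.of_forall fun x => hψ2 _)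
    have h3 : |∫ x, ψ (f.eval x) * (τ ^ 2 / (p.eval x ^ 2 + τ ^ 2)) ∂stdGauss| ≤
        2 * ∫ x, τ ^ 2 / (p.eval x ^ 2 + τ ^ 2) ∂stdGauss := by
      rw [← integral_const_mul, ← Real.norm_eq_abs]
      refine norm_integral_le_of_norm_le (hqi.const_mul 2)
        (Filter.Eventually.of_forall fun x => ?_)
      rw [Real.norm_eq_abs, abs_mul, abs_of_nonneg (hq0 x)]
      exact mul_le_mul_of_nonneg_right (hψ2 _) (hq0 x)
    have hsplit : ∫ x, ψ (f.eval x) ∂stdGauss =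
        ∫ x, ψ (f.eval x) * (p.eval x * (p.eval x / (p.eval x ^ 2 + τ ^ 2))) ∂stdGauss +
        ∫ x, ψ (f.eval x) * (τ ^ 2 / (p.eval x ^ 2 + τ ^ 2)) ∂stdGauss := by
      have he (x : ℝ) : ψ (f.eval x) * (p.eval x * (p.eval x / (p.eval x ^ 2 + τ ^ 2))) =
          ψ (f.eval x) - ψ (f.eval x) * (τ ^ 2 / (p.eval x ^ 2 + τ ^ 2)) := by
        have : p.eval x ^ 2 + τ ^ 2 ≠ 0 := by positivity
        field_simp
        ring
      simp_rw [he]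
      rw [integral_sub hψi hψqi]
      ring
    rw [hsplit]
    refine (abs_add_le _ _).trans ((add_le_add (h1.trans
      (mul_le_mul_of_nonneg_left (add_le_add le_rfl hkb) hb.le)) h3).trans ?_)
    rw [hτn] at h2
    have h4 : b * (1 / τ * E + n * Real.pi / τ) = (E + n * Real.pi) * b ^ r := by
      rw [← hbτ]; ring
    rw [← hEdef, h4]
    linarith

/-! ### Estimates for image measures -/

theorem imageDist_le_of_forall_continuous {f g : ℝ → ℝ} (hf : Continuous f) (hg : Continuous g)
    {B : ℝ} (h : ∀ φ : ℝ → ℝ, Continuous φ → (∀ x, |φ x| ≤ 1) →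
      |∫ x, φ (f x) ∂stdGauss - ∫ x, φ (g x) ∂stdGauss| ≤ B) :
    imageDist stdGauss f g ≤ B := by
  refine tvDist_le_of_forall_continuous _ _ fun φ hφ hφ1 => ?_
  rw [integral_map hf.aemeasurable hφ.aestronglyMeasurable,
    integral_map hg.aemeasurable hφ.aestronglyMeasurable]
  exact h φ hφ hφ1

theorem imageDist_self (f : ℝ → ℝ) : imageDist stdGauss f f = 0 := tvDist_self _

theorem exists_hasDerivAt_of_continuous {φ : ℝ → ℝ} (hφ : Continuous φ) :
    ∃ F : ℝ → ℝ, ∀ y, HasDerivAt F (φ y) y :=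
  ⟨fun y => ∫ t in (0 : ℝ)..y, φ t, fun y => (hφ.integral_hasStrictDerivAt 0 y).hasDerivAt⟩

theorem abs_sub_le_of_hasDerivAt {F φ : ℝ → ℝ} {c : ℝ} (hF : ∀ y, HasDerivAt F (φ y) y)
    (hc : ∀ y, |φ y| ≤ c) (x y : ℝ) : |F x - F y| ≤ c * |x - y| :=
  Convex.norm_image_sub_le_of_norm_hasDerivWithin_le (s := Set.univ)
    (fun z _ => (hF z).hasDerivWithinAt) (fun z _ => hc z) convex_univ (Set.mem_univ y)
    (Set.mem_univ x)

/-- If `F' = φ`, then `F - F(· + u)` is a primitive of `φ - φ(· + u)` and is bounded by `|u|`,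
because `F` is 1-Lipschitz. -/
theorem shiftCondition_of_abs_integral_comp_le {m : ℕ} {C : ℝ} (hC : 0 < C) (f : ℝ[X])
    (h : ∀ (Φ ψ : ℝ → ℝ) (b : ℝ), 0 < b → (∀ y, HasDerivAt Φ (ψ y) y) → Continuous ψ →
        (∀ y, |Φ y| ≤ b) → (∀ y, |ψ y| ≤ 2) →
        |∫ x, ψ (f.eval x) ∂stdGauss| ≤ C * b ^ (1 / (m : ℝ))) :
    ShiftCondition stdGauss (fun x => f.eval x) (1 / (m : ℝ)) C := by
  intro u
  rcases eq_or_ne u 0 with rfl | hu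
  · simp only [add_zero, imageDist_self]
    positivity
  refine imageDist_le_of_forall_continuous (by fun_prop) (by fun_prop) fun φ hφ hφ1 => ?_
  obtain ⟨F, hF⟩ := exists_hasDerivAt_of_continuous hφ
  have h1 := h (fun y => F y - F (y + u)) (fun y => φ y - φ (y + u)) |u| (abs_pos.2 hu)
    (fun y => (hF y).sub ((hF (y + u)).comp_add_const y u)) (by fun_prop)
    (fun y => by simpa using abs_sub_le_of_hasDerivAt hF hφ1 y (y + u))
    (fun y => (abs_sub _ _).trans (by linarith [hφ1 y, hφ1 (y + u)]))
  rwa [integral_sub] at h1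
  · exact Integrable.of_bound (by fun_prop) 1 (Filter.Eventually.of_forall fun x => hφ1 _)
  · exact Integrable.of_bound (by fun_prop) 1 (Filter.Eventually.of_forall fun x => hφ1 _)

theorem abs_coeff_sub_le_coeffDist {m k : ℕ} (hk : k ≤ m) (f g : ℝ[X]) :
    |f.coeff k - g.coeff k| ≤ coeffDist m f g :=
  Finset.le_sup' (fun k => |f.coeff k - g.coeff k|) (Finset.mem_range.2 (Nat.lt_succ_of_le hk))

theorem coeffDist_nonneg (m : ℕ) (f g : ℝ[X]) : 0 ≤ coeffDist m f g :=
  (abs_nonneg _).trans (abs_coeff_sub_le_coeffDist m.zero_le f g)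

theorem eq_of_coeffDist_eq_zero {m : ℕ} {f g : ℝ[X]} (hf : f.natDegree ≤ m)
    (hg : g.natDegree ≤ m) (h : coeffDist m f g = 0) : f = g := by
  ext k
  rcases le_or_gt k m with hk | hk
  · have := abs_coeff_sub_le_coeffDist hk f g
    rw [h] at this
    exact sub_eq_zero.1 (abs_nonpos_iff.1 this)
  · rw [coeff_eq_zero_of_natDegree_lt (hf.trans_lt hk),
      coeff_eq_zero_of_natDegree_lt (hg.trans_lt hk)]

theorem integral_abs_eval_sub_le {m : ℕ} {f g : ℝ[X]} (hf : f.natDegree ≤ m)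
    (hg : g.natDegree ≤ m) :
    ∫ x, |f.eval x - g.eval x| ∂stdGauss ≤
      (m + 1) * coeffDist m f g * ∫ x, (1 + |x|) ^ m ∂stdGauss := by
  rw [← integral_const_mul]
  refine integral_mono ((integrable_eval f).sub (integrable_eval g)).abs
    ((integrable_one_add_abs_pow m).const_mul _) fun x => ?_
  have := abs_eval_le (p := f - g) ((natDegree_sub_le f g).trans (max_le hf hg))
    (c := coeffDist m f g) (fun k hk => by
      rw [coeff_sub]; exact abs_coeff_sub_le_coeffDist hk f g) x
  simpa using this

/-- Comparison of the laws of `f(X)` and `g(X)` at smoothing scale `ε`. -/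
theorem imageDist_le_of_smoothing {f g : ℝ[X]} {ε B₁ B₂ : ℝ} (hε : 0 < ε)
    (hf : ∀ Φ ψ : ℝ → ℝ, (∀ y, HasDerivAt Φ (ψ y) y) → Continuous ψ →
        (∀ y, |Φ y| ≤ ε) → (∀ y, |ψ y| ≤ 2) → |∫ x, ψ (f.eval x) ∂stdGauss| ≤ B₁)
    (hg : ∀ Φ ψ : ℝ → ℝ, (∀ y, HasDerivAt Φ (ψ y) y) → Continuous ψ →
        (∀ y, |Φ y| ≤ ε) → (∀ y, |ψ y| ≤ 2) → |∫ x, ψ (g.eval x) ∂stdGauss| ≤ B₂) :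
    imageDist stdGauss (fun x => f.eval x) (fun x => g.eval x) ≤
      B₁ + B₂ + 2 / ε * ∫ x, |f.eval x - g.eval x| ∂stdGauss := by
  refine imageDist_le_of_forall_continuous (by fun_prop) (by fun_prop) fun φ hφ hφ1 => ?_
  obtain ⟨F, hF⟩ := exists_hasDerivAt_of_continuous hφ
  have hFc : Continuous F := continuous_iff_continuousAt.2 fun x => (hF x).continuousAt
  obtain ⟨G, hG⟩ := exists_hasDerivAt_of_continuous hFc
  -- The average of `φ` over `[y, y + ε]`; its primitive is the corresponding average of `F`.
  set χ : ℝ → ℝ := fun y => (F (y + ε) - F y) / ε with hχ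
  have hχc : Continuous χ := by fun_prop
  have hχ1 (y : ℝ) : |χ y| ≤ 1 := by
    rw [hχ, abs_div, abs_of_pos hε, div_le_one hε]
    simpa [abs_of_pos hε] using abs_sub_le_of_hasDerivAt hF hφ1 (y + ε) y
  have hχL (x y : ℝ) : |χ x - χ y| ≤ 2 / ε * |x - y| := by
    refine abs_sub_le_of_hasDerivAt (φ := fun y => (φ (y + ε) - φ y) / ε)
      (fun y => (((hF (y + ε)).comp_add_const y ε).sub (hF y)).div_const ε) (fun y => ?_) x y
    rw [abs_div, abs_of_pos hε]
    gcongr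
    exact (abs_sub _ _).trans (by linarith [hφ1 y, hφ1 (y + ε)])
  have hΨ (y : ℝ) : HasDerivAt (fun y => F y - (G (y + ε) - G y) / ε) (φ y - χ y) y :=
    (hF y).sub ((((hG (y + ε)).comp_add_const y ε).sub (hG y)).div_const ε)
  have hΨb (y : ℝ) : |F y - (G (y + ε) - G y) / ε| ≤ ε := by
    -- By the mean value theorem the average of `F` is a value `F ξ` with `ξ` within `ε` of `y`.
    obtain ⟨ξ, hξ, he⟩ := exists_hasDerivAt_eq_slope G F (by linarith : y < y + ε)
      (fun x _ => (hG x).continuousAt.continuousWithinAt) fun x _ => hG x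
    rw [add_sub_cancel_left] at he
    rw [← he]
    refine (abs_sub_le_of_hasDerivAt hF hφ1 y ξ).trans ?_
    rw [one_mul, abs_le]
    constructor <;> linarith [hξ.1, hξ.2]
  have hψ2 (y : ℝ) : |φ y - χ y| ≤ 2 := (abs_sub _ _).trans (by linarith [hφ1 y, hχ1 y])
  have hi (θ : ℝ → ℝ) (hθ : Continuous θ) (hθ1 : ∀ y, |θ y| ≤ 1) (p : ℝ[X]) :
      Integrable (fun x => θ (p.eval x)) stdGauss :=
    Integrable.of_bound (by fun_prop) 1 (Filter.Eventually.of_forall fun x => hθ1 _)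
  have h1 := hf _ _ hΨ (by fun_prop) hΨb hψ2
  have h2 := hg _ _ hΨ (by fun_prop) hΨb hψ2
  rw [integral_sub (hi φ hφ hφ1 _) (hi χ hχc hχ1 _)] at h1 h2
  have h3 : |∫ x, χ (f.eval x) ∂stdGauss - ∫ x, χ (g.eval x) ∂stdGauss| ≤
      2 / ε * ∫ x, |f.eval x - g.eval x| ∂stdGauss := by
    rw [← integral_sub (hi χ hχc hχ1 _) (hi χ hχc hχ1 _), ← integral_const_mul,
      ← Real.norm_eq_abs]
    exact norm_integral_le_of_norm_le
      (((integrable_eval f).sub (integrable_eval g)).abs.const_mul _)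
      (Filter.Eventually.of_forall fun x => hχL _ _)
  rw [abs_le] at h1 h2 h3 ⊢
  constructor <;> linarith [h1.1, h1.2, h2.1, h2.2, h3.1, h3.2]

end ImageTV

theorem mainTheorem5 (m : ℕ) (hm : 1 ≤ m) :
    (∀ f : Polynomial ℝ, f.natDegree = m →
      ∃ C : ℝ, 0 < C ∧
        ImageTV.ShiftCondition ImageTV.stdGauss (fun x => f.eval x) (1 / (m : ℝ)) C) ∧
    (∃ C : ℝ → ℝ → ℝ, (∀ s t : ℝ, 0 < s → 0 < t → 0 < C s t) ∧
      ∀ f g : Polynomial ℝ, 1 ≤ f.natDegree → f.natDegree ≤ m →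
        1 ≤ g.natDegree → g.natDegree ≤ m →
        ImageTV.imageDist ImageTV.stdGauss (fun x => f.eval x) (fun x => g.eval x) ≤
          C (ImageTV.gradNorm f) (ImageTV.gradNorm g) *
            ImageTV.coeffDist m f g ^ (1 / ((m : ℝ) + 1))) := by
  -- Keeping `0 < s` inside the existential lets `choose` give a constant that is a function of the
  -- gradient norm alone.
  have key : ∀ s : ℝ, ∃ C : ℝ, 0 < s → 0 < C ∧ ∀ f : ℝ[X], f.natDegree ≤ m →
      ImageTV.gradNorm f = s →
      ∀ (Φ ψ : ℝ → ℝ) (b : ℝ), 0 < b → (∀ y, HasDerivAt Φ (ψ y) y) → Continuous ψ →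
        (∀ y, |Φ y| ≤ b) → (∀ y, |ψ y| ≤ 2) →
        |∫ x, ψ (f.eval x) ∂ImageTV.stdGauss| ≤ C * b ^ (1 / (m : ℝ)) := by
    intro s
    by_cases hs : 0 < s
    · obtain ⟨C, hC⟩ := ImageTV.exists_abs_integral_comp_le hm hs
      exact ⟨C, fun _ => hC⟩
    · exact ⟨0, fun h => absurd h hs⟩
  choose C hC using key
  have hm0 : (0 : ℝ) < m := by exact_mod_cast hm
  refine ⟨fun f hf => ?_, fun s t => C s + C t +
    2 * (m + 1) * ∫ x, (1 + |x|) ^ m ∂ImageTV.stdGauss, fun s t hs ht => ?_,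
    fun f g hf1 hfm hg1 hgm => ?_⟩
  · obtain ⟨h0, h⟩ := hC _ (ImageTV.gradNorm_pos (hf ▸ hm))
    exact ⟨_, h0, ImageTV.shiftCondition_of_abs_integral_comp_le h0 f (h f hf.le rfl)⟩
  · have h1 := (hC s hs).1
    have h2 := (hC t ht).1
    have h3 := ImageTV.one_le_integral_one_add_abs_pow m
    positivity
  · obtain ⟨-, hf⟩ := hC _ (ImageTV.gradNorm_pos hf1)
    obtain ⟨-, hg⟩ := hC _ (ImageTV.gradNorm_pos hg1)
    rcases (ImageTV.coeffDist_nonneg m f g).eq_or_lt' with h0 | hδ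
    · rw [h0, ImageTV.eq_of_coeffDist_eq_zero hfm hgm h0, ImageTV.imageDist_self,
        Real.zero_rpow (by positivity), mul_zero]
    have hsub := ImageTV.integral_abs_eval_sub_le hfm hgm
    set δ := ImageTV.coeffDist m f g with hδdef
    set r : ℝ := 1 / ((m : ℝ) + 1) with hr
    -- Solves `ε ^ (1/m) = δ/ε`; the common value is `δ ^ (1/(m+1))`.
    set ε : ℝ := δ ^ (m * r) with hεdef
    have hε : 0 < ε := by positivity
    have hδε : δ / ε = δ ^ r := by
      rw [hεdef, div_eq_iff (by positivity), ← Real.rpow_add hδ]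
      have : r + m * r = 1 := by rw [hr]; field_simp; ring
      rw [this, Real.rpow_one]
    have hεm : ε ^ (1 / (m : ℝ)) = δ ^ r := by
      rw [hεdef, ← Real.rpow_mul hδ.le]
      congr 1
      field_simp
    refine (ImageTV.imageDist_le_of_smoothing hε (fun Φ ψ => hf f hfm rfl Φ ψ ε hε)
      (fun Φ ψ => hg g hgm rfl Φ ψ ε hε)).trans ?_
    have h1 := mul_le_mul_of_nonneg_left hsub (by positivity : 0 ≤ 2 / ε)
    have h2 : 2 / ε * ((m + 1) * δ * ∫ x, (1 + |x|) ^ m ∂ImageTV.stdGauss) =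
        2 * (m + 1) * (∫ x, (1 + |x|) ^ m ∂ImageTV.stdGauss) * δ ^ r := by
      rw [← hδε]; ring
    rw [hεm]
    linarith
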